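/- For a polynomial $p\in\mathbb C[t]$ let $\|p\|$ denote the sum of the absolute values of its coefficients. There is an absolute constant $C$ with the following property. Let $n\ge 0$ and $d\ge 1$ be integers, let $K\in\mathbb R$, and let $a_0,a_1,\dots,a_n\in\mathbb C[t]$ be polynomials of degree at most $d$ such that $\|a_0\|=1$ and $\|a_k\|\le K$ for $k=1,\dots,n$. Then any entire function $y:\mathbb C\to\mathbb C$ satisfying $$a_0(t)\,y^{(n)}(t)+a_1(t)\,y^{(n-1)}(t)+\dots+a_n(t)\,y(t)=0\qquad\text{for all }t\in\mathbb C$$ has at most $\max(K,1)\cdot n\cdot 2^{Cd}$ isolated zeros, counted with multiplicity, in the open unit disk $\{|t|<1\}$. (The identically zero solution has no isolated zeros.) -/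

import Mathlib

open Polynomial Filter Topology

/-- The `ℓ¹`-norm of a complex polynomial: the sum of the absolute values of its coefficients. -/
noncomputable def polyL1Norm (p : ℂ[X]) : ℝ :=
  ∑ i ∈ p.support, ‖p.coeff i‖

/-- `y` solves the homogeneous linear equation
`a₀(t) y⁽ⁿ⁾ + a₁(t) y⁽ⁿ⁻¹⁾ + ⋯ + aₙ(t) y = 0` at every point `t ∈ ℂ`. -/
def IsEntireSolution {n : ℕ} (a : Fin (n + 1) → ℂ[X]) (y : ℂ → ℂ) : Prop :=
  Differentiable ℂ y ∧
    ∀ t : ℂ, ∑ k : Fin (n + 1), (a k).eval t * iteratedDeriv (n - (k : ℕ)) y t = 0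

/-- The isolated zeros of `y` in the open unit disk. For entire `y` this is the whole zero set in
the disk, unless `y` vanishes identically, when it is empty. -/
def isolatedZerosInUnitDisk (y : ℂ → ℂ) : Set ℂ :=
  {t | ‖t‖ < 1 ∧ y t = 0 ∧ ∀ᶠ s in 𝓝[≠] t, y s ≠ 0}

/-! Compare `y` on the disk of radius 2 with `y` on a circle of radius `R ≥ 7`. Dividing out `N`
zeros of the unit disk and applying the maximum principle gives `2 ^ N ≤` growth ratio
(`two_pow_mul_norm_le`), so it suffices to bound the growth by `exp (72 * l)`, with `l` of order
`max K 1 * n * 648 ^ d`.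

Growth is controlled by Grönwall for the scaled jet `y⁽ᵏ⁾ / l ^ k` (`JetBound.along_path`), along
paths where `a₀` is not small. Projecting the roots of `a₀` to moduli or to imaginary parts and
applying Chebyshev's extremal property yields a whole circle and a whole horizontal line on which
`‖a₀‖ ≥ 72 ^ (-d)`. The path follows the line from near the origin to the circle, then an arc. The
scaling keeps the bound linear in `n`: it absorbs both the factorials from Cauchy's estimates and
the `n` terms of the equation. -/

/-! ### Lower bounds for a normalised polynomial on a circle and on a line -/

/-- Chebyshev: a monic real polynomial with real roots is not small everywhere on `[-1, 1]`. -/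
lemma exists_le_prod_abs_sub (s : Multiset ℝ) :
    ∃ x ∈ Set.Icc (-1 : ℝ) 1, (1 / 2 : ℝ) ^ s.card ≤ (s.map fun r ↦ |x - r|).prod := by
  by_contra! h
  set P : ℝ[X] := (s.map fun r ↦ X - C r).prod with hP
  have hmon : P.Monic := monic_multiset_prod_of_monic _ _ fun r _ ↦ monic_X_sub_C r
  have hdeg : P.natDegree = s.card := natDegree_multiset_prod_X_sub_C_eq_card s
  have heval : ∀ x, |P.eval x| = (s.map fun r ↦ |x - r|).prod := by
    intro x
    rw [hP, eval_multiset_prod]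
    refine (map_multiset_prod (absHom (α := ℝ)) _).trans ?_
    simp [Multiset.map_map, absHom]
  -- Chebyshev's bound is `2 ^ (card - 1)` with truncated subtraction, so an empty `s` would give no
  -- contradiction.
  have hs : s.card ≠ 0 := by
    intro h0
    have := h 0 (by norm_num)
    simp [Multiset.card_eq_zero.mp h0] at this
  have hc : (C ((2 : ℝ) ^ s.card) * P).leadingCoeff = 2 ^ s.card := by
    rw [leadingCoeff_mul, hmon.leadingCoeff, leadingCoeff_C, mul_one]
  have key := Chebyshev.leadingCoeff_le_of_forall_abs_le_one (n := s.card)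
    (P := C ((2 : ℝ) ^ s.card) * P) ?_ ?_
  · rw [hc] at key
    obtain ⟨k, hk⟩ := Nat.exists_eq_succ_of_ne_zero hs
    rw [hk] at key
    simp only [Nat.succ_eq_add_one, Nat.add_sub_cancel, pow_succ] at key
    have : (0 : ℝ) < 2 ^ k := by positivity
    linarith
  · rw [degree_C_mul (by positivity), ← hdeg]
    exact degree_le_natDegree
  · intro x hx
    have := (h x (by simpa [abs_le] using hx)).le
    rw [eval_mul, eval_C, abs_mul, heval, abs_of_pos (by positivity)]
    calc (2 : ℝ) ^ s.card * _ ≤ 2 ^ s.card * (1 / 2) ^ s.card := by gcongr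
      _ = 1 := by rw [← mul_pow]; norm_num

lemma polyL1Norm_nonneg (p : ℂ[X]) : 0 ≤ polyL1Norm p :=
  Finset.sum_nonneg fun _ _ ↦ norm_nonneg _

lemma norm_eval_le_polyL1Norm_mul {p : ℂ[X]} {d : ℕ} (hp : p.natDegree ≤ d) {r : ℝ} (hr : 1 ≤ r)
    {t : ℂ} (ht : ‖t‖ ≤ r) : ‖p.eval t‖ ≤ polyL1Norm p * r ^ d := by
  rw [eval_eq_sum, Polynomial.sum, polyL1Norm, Finset.sum_mul]
  refine norm_sum_le_of_le _ fun i hi ↦ ?_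
  rw [norm_mul, norm_pow]
  gcongr
  calc ‖t‖ ^ i ≤ r ^ i := by gcongr
    _ ≤ r ^ d := pow_le_pow_right₀ hr ((le_natDegree_of_mem_supp i hi).trans hp)

/-- Turns the normalisation `‖a₀‖ = 1` into a lower bound for `|lead| * ∏ max 1 ‖z‖` over the roots.
-/
lemma polyL1Norm_le_two_pow_mul_mahlerMeasure (p : ℂ[X]) :
    polyL1Norm p ≤ 2 ^ p.natDegree * p.mahlerMeasure := by
  calc polyL1Norm p ≤ ∑ i ∈ Finset.range (p.natDegree + 1), ‖p.coeff i‖ :=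
        Finset.sum_le_sum_of_subset_of_nonneg supp_subset_range_natDegree_succ
          fun _ _ _ ↦ norm_nonneg _
    _ ≤ ∑ i ∈ Finset.range (p.natDegree + 1), (p.natDegree.choose i : ℝ) * p.mahlerMeasure :=
        Finset.sum_le_sum fun i _ ↦ norm_coeff_le_choose_mul_mahlerMeasure i p
    _ = 2 ^ p.natDegree * p.mahlerMeasure := by
        rw [← Finset.sum_mul]
        congr 1
        exact_mod_cast Nat.sum_range_choose _

/-- A lower bound for `‖p(t)‖` from lower bounds for the distances to the roots of `p`, weighted
by real numbers whose product is controlled. -/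
lemma le_norm_eval_of_forall_root {p : ℂ[X]} {d : ℕ} (hp : p.natDegree ≤ d)
    (h1 : polyL1Norm p = 1) {ρ : ℂ → ℝ} {x : ℝ}
    (hx : (1 / 2 : ℝ) ^ p.roots.card ≤ ((p.roots.map ρ).map fun r ↦ |x - r|).prod) {t : ℂ}
    (ht : ∀ z, max 1 ‖z‖ * |x - ρ z| ≤ 18 * ‖t - z‖) : 1 ≤ 72 ^ d * ‖p.eval t‖ := by
  have hcard : p.roots.card = p.natDegree := IsAlgClosed.card_roots_eq_natDegree
  have hev : ‖p.eval t‖ = ‖p.leadingCoeff‖ * (p.roots.map fun z ↦ ‖t - z‖).prod := by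
    conv_lhs => rw [(IsAlgClosed.splits p).eq_prod_roots]
    rw [eval_mul, eval_C, norm_mul, eval_multiset_prod]
    congr 1
    refine (map_multiset_prod (normHom (α := ℂ)) _).trans ?_
    simp [Multiset.map_map, normHom]
  have hM := polyL1Norm_le_two_pow_mul_mahlerMeasure p
  rw [h1, mahlerMeasure_eq_leadingCoeff_mul_prod_roots] at hM
  have hprod : (p.roots.map fun z ↦ max 1 ‖z‖ * |x - ρ z|).prod
      ≤ (p.roots.map fun z ↦ 18 * ‖t - z‖).prod :=
    Multiset.prod_map_le_prod_map₀ _ _ (fun z _ ↦ by positivity) fun z _ ↦ ht z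
  rw [Multiset.prod_map_mul, Multiset.prod_map_mul, Multiset.map_const', Multiset.prod_replicate,
    hcard] at hprod
  rw [Multiset.map_map, hcard] at hx
  have hA : (0 : ℝ) ≤ (p.roots.map fun z ↦ max 1 ‖z‖).prod :=
    Multiset.prod_nonneg (by simp only [Multiset.mem_map]; rintro _ ⟨z, -, rfl⟩; positivity)
  set A := (p.roots.map fun z ↦ max 1 ‖z‖).prod
  set n := p.natDegree
  calc (1 : ℝ) ≤ 2 ^ n * (‖p.leadingCoeff‖ * A) := hM
    -- One factor `2 ^ n` is the loss in Mahler's inequality, the other the loss in Chebyshev's.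
    _ = 4 ^ n * ‖p.leadingCoeff‖ * (A * (1 / 2) ^ n) := by
        have : (4 : ℝ) ^ n = 2 ^ n * 2 ^ n := by rw [← mul_pow]; norm_num
        rw [this, one_div, inv_pow]; field_simp
    _ ≤ 4 ^ n * ‖p.leadingCoeff‖ * (18 ^ n * (p.roots.map fun z ↦ ‖t - z‖).prod) := by
        refine mul_le_mul_of_nonneg_left (le_trans ?_ hprod) (by positivity)
        gcongr
        exact hx
    _ = 72 ^ n * ‖p.eval t‖ := by
        rw [hev, show (72 : ℝ) = 4 * 18 by norm_num, mul_pow]; ring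
    _ ≤ 72 ^ d * ‖p.eval t‖ := by
        gcongr
        norm_num

/-- A root with `‖z‖ > 18` satisfies `‖t - z‖ ≥ ‖z‖ / 2`, so its projection is irrelevant and is
replaced by the dummy value 0. -/
lemma max_one_norm_mul_le {z t : ℂ} {x r : ℝ} (hx : |x| ≤ 1) (ht : ‖t‖ ≤ 9)
    (h : |x - r| ≤ ‖t - z‖) :
    max 1 ‖z‖ * |x - if ‖z‖ ≤ 18 then r else 0| ≤ 18 * ‖t - z‖ := by
  split_ifs with hz
  · gcongr
    simp [hz]
  · push Not at hz
    have h2 := norm_sub_norm_le z t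
    rw [norm_sub_rev] at h2
    rw [sub_zero, max_eq_right (by linarith)]
    nlinarith [abs_nonneg x]

lemma exists_circle_le_norm_eval {p : ℂ[X]} {d : ℕ} (hp : p.natDegree ≤ d)
    (h1 : polyL1Norm p = 1) :
    ∃ R ∈ Set.Icc (7 : ℝ) 9, ∀ t : ℂ, ‖t‖ = R → 1 ≤ 72 ^ d * ‖p.eval t‖ := by
  obtain ⟨x, hx, hx'⟩ := exists_le_prod_abs_sub
    -- The shift by 8 carries the radii `[7, 9]` to `[-1, 1]`.
    (p.roots.map fun z ↦ if ‖z‖ ≤ 18 then ‖z‖ - 8 else 0)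
  rw [Multiset.card_map] at hx'
  refine ⟨8 + x, ⟨by linarith [hx.1], by linarith [hx.2]⟩, fun t ht ↦
    le_norm_eval_of_forall_root hp h1 hx' fun z ↦ max_one_norm_mul_le (abs_le.mpr hx) ?_ ?_⟩
  · linarith [hx.2]
  · have := abs_norm_sub_norm_le t z
    rwa [ht, show 8 + x - ‖z‖ = x - (‖z‖ - 8) by ring] at this

lemma exists_line_le_norm_eval {p : ℂ[X]} {d : ℕ} (hp : p.natDegree ≤ d)
    (h1 : polyL1Norm p = 1) :
    ∃ h ∈ Set.Icc (-1 : ℝ) 1, ∀ t : ℂ, ‖t‖ ≤ 9 → t.im = h → 1 ≤ 72 ^ d * ‖p.eval t‖ := by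
  obtain ⟨x, hx, hx'⟩ := exists_le_prod_abs_sub
    (p.roots.map fun z ↦ if ‖z‖ ≤ 18 then z.im else 0)
  rw [Multiset.card_map] at hx'
  refine ⟨x, hx, fun t ht hi ↦
    le_norm_eval_of_forall_root hp h1 hx' fun z ↦ max_one_norm_mul_le (abs_le.mpr hx) ht ?_⟩
  simpa [hi] using Complex.abs_im_le_norm (t - z)

/-! ### Grönwall's inequality for the scaled jet -/

/-- The derivatives of `y` at `t` of order less than `n` are bounded by `J * l ^ k`. -/
def JetBound (y : ℂ → ℂ) (l : ℝ) (n : ℕ) (J : ℝ) (t : ℂ) : Prop :=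
  ∀ k < n, ‖iteratedDeriv k y t‖ ≤ J * l ^ k

/-- Grönwall's inequality for the scaled jet of `y` along a path. -/
lemma JetBound.along_path {y : ℂ → ℂ} (hy : Differentiable ℂ y) {l v L m : ℝ} {n : ℕ}
    (hl : 0 < l) (hL : 0 ≤ L) (hm : 0 ≤ m) {γ γ' : ℝ → ℂ} (hγ : ∀ s, HasDerivAt γ (γ' s) s)
    (hv : ∀ s, ‖γ' s‖ ≤ v) (h0 : JetBound y l n m (γ 0))
    (hode : ∀ s ∈ Set.Icc 0 L, ∀ J, 0 ≤ J → JetBound y l n J (γ s) →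
      ‖iteratedDeriv n y (γ s)‖ ≤ J * l ^ n) :
    JetBound y l n (m * Real.exp (l * v * L)) (γ L) := by
  have hdiff : ∀ k, Differentiable ℂ (iteratedDeriv k y) := fun k ↦
    (hy.contDiff (n := ⊤)).differentiable_iteratedDeriv k (WithTop.coe_lt_top _)
  set f : ℝ → Fin n → ℂ := fun s k ↦ iteratedDeriv k y (γ s) / (l : ℂ) ^ (k : ℕ) with hf
  set f' : ℝ → Fin n → ℂ := fun s k ↦
    (γ' s • iteratedDeriv (k + 1) y (γ s)) / (l : ℂ) ^ (k : ℕ) with hf'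
  have hder : ∀ s, HasDerivAt f (f' s) s := by
    intro s
    rw [hasDerivAt_pi]
    intro k
    refine HasDerivAt.div_const ?_ _
    have := (hdiff k (γ s)).hasDerivAt
    rw [← iteratedDeriv_succ] at this
    exact this.scomp s (hγ s)
  have hnorm : ∀ s (k : Fin n), ‖f s k‖ = ‖iteratedDeriv k y (γ s)‖ / l ^ (k : ℕ) := by
    intro s k
    simp [hf, abs_of_pos hl]
  have hjet : ∀ s, JetBound y l n ‖f s‖ (γ s) := by
    intro s k hk
    have := norm_le_pi_norm (f s) ⟨k, hk⟩
    rwa [hnorm, div_le_iff₀ (by positivity)] at this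
  have hv0 : 0 ≤ v := (norm_nonneg _).trans (hv 0)
  have hbound : ∀ s ∈ Set.Ico 0 L, ‖f' s‖ ≤ l * v * ‖f s‖ + 0 := by
    intro s hs
    rw [add_zero, pi_norm_le_iff_of_nonneg (by positivity)]
    intro k
    have hk : ‖iteratedDeriv (k + 1) y (γ s)‖ ≤ ‖f s‖ * l ^ ((k : ℕ) + 1) := by
      rcases Nat.lt_or_ge ((k : ℕ) + 1) n with h | h
      · exact hjet s _ h
      · have : (k : ℕ) + 1 = n := le_antisymm k.2 h
        rw [this]
        exact hode s ⟨hs.1, hs.2.le⟩ _ (norm_nonneg _) (hjet s)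
    simp only [hf', norm_div, norm_smul, norm_pow, Complex.norm_real, Real.norm_eq_abs,
      abs_of_pos hl]
    rw [div_le_iff₀ (by positivity)]
    calc _ ≤ v * (‖f s‖ * l ^ ((k : ℕ) + 1)) := by gcongr; exact hv s
      _ = _ := by ring
  have hinit : ‖f 0‖ ≤ m := by
    rw [pi_norm_le_iff_of_nonneg hm]
    intro k
    rw [hnorm, div_le_iff₀ (by positivity)]
    exact h0 k k.2
  have hmain := norm_le_gronwallBound_of_norm_deriv_right_le
    (fun s _ ↦ (hder s).continuousAt.continuousWithinAt)
    (fun s _ ↦ (hder s).hasDerivWithinAt) hinit hbound L ⟨hL, le_rfl⟩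
  rw [gronwallBound_ε0, sub_zero] at hmain
  intro k hk
  refine (hjet L k hk).trans ?_
  gcongr

/-! ### Dividing out zeros and the maximum principle -/

lemma exists_eq_sub_pow_mul {f : ℂ → ℂ} (hf : Differentiable ℂ f) (a : ℂ) {m : ℕ}
    (hm : (m : ℕ∞) ≤ analyticOrderAt f a) :
    ∃ g : ℂ → ℂ, Differentiable ℂ g ∧ ∀ z, f z = (z - a) ^ m * g z := by
  induction m generalizing f with
  | zero => exact ⟨f, hf, by simp⟩
  | succ m ih =>
    have hg : Differentiable ℂ (dslope f a) := by
      rw [← differentiableOn_univ]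
      exact (Complex.differentiableOn_dslope univ_mem).mpr hf.differentiableOn
    have ha : f a = 0 := by
      apply apply_eq_zero_of_analyticOrderAt_ne_zero
      intro h
      simp [h] at hm
    have heq : f = (id - fun _ ↦ a) * dslope f a := by
      ext z
      have := sub_smul_dslope f a z
      simpa [ha] using this.symm
    have hid : AnalyticAt ℂ (id - fun _ ↦ a) a := analyticAt_id.sub analyticAt_const
    have hord : analyticOrderAt f a = 1 + analyticOrderAt (dslope f a) a := by
      conv_lhs => rw [heq]
      rw [analyticOrderAt_mul hid (hg.analyticAt a)]
      congr 1
      exact analyticOrderAt_id_sub_const_self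
    obtain ⟨g, hgd, hgm⟩ := ih hg (by
      rw [hord, Nat.cast_add, Nat.cast_one, add_comm] at hm
      exact (ENat.add_le_add_iff_left (by simp)).mp hm)
    refine ⟨g, hgd, fun z ↦ ?_⟩
    rw [pow_succ', mul_assoc, ← hgm]
    exact congrFun heq z

lemma exists_eq_prod_sub_pow_mul {f : ℂ → ℂ} (hf : Differentiable ℂ f) (S : Finset ℂ)
    {m : ℂ → ℕ} (hm : ∀ a ∈ S, (m a : ℕ∞) ≤ analyticOrderAt f a) :
    ∃ g : ℂ → ℂ, Differentiable ℂ g ∧ ∀ z, f z = (∏ a ∈ S, (z - a) ^ m a) * g z := by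
  induction S using Finset.induction_on generalizing f with
  | empty => exact ⟨f, hf, by simp⟩
  | insert a S ha ih =>
    obtain ⟨g, hg, hfg⟩ := exists_eq_sub_pow_mul hf a (hm a (Finset.mem_insert_self a S))
    obtain ⟨h, hh, hgh⟩ := ih hg fun b hb ↦ by
      refine (hm b (Finset.mem_insert_of_mem hb)).trans_eq ?_
      have hba : b ≠ a := fun h ↦ ha (h ▸ hb)
      have hp : Differentiable ℂ fun z : ℂ ↦ (z - a) ^ m a := by fun_prop
      have : f = (fun z ↦ (z - a) ^ m a) * g := funext hfg
      rw [this, analyticOrderAt_mul (hp.analyticAt b) (hg.analyticAt b),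
        (hp.analyticAt b).analyticOrderAt_eq_zero.mpr (pow_ne_zero _ (sub_ne_zero.mpr hba)),
        zero_add]
    exact ⟨h, hh, fun z ↦ by rw [Finset.prod_insert ha, hfg, hgh]; ring⟩

/-- Each zero in the unit disk makes the maximum over `‖t‖ ≤ 2` smaller by a factor of two. -/
lemma two_pow_mul_norm_le {f : ℂ → ℂ} (hf : Differentiable ℂ f) {S : Finset ℂ}
    (hS : ∀ a ∈ S, ‖a‖ ≤ 1) {m : ℂ → ℕ} (hm : ∀ a ∈ S, (m a : ℕ∞) ≤ analyticOrderAt f a)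
    {R M : ℝ} (hR : 7 ≤ R) (hM : ∀ t, ‖t‖ = R → ‖f t‖ ≤ M) {t : ℂ} (ht : ‖t‖ ≤ 2) :
    2 ^ (∑ a ∈ S, m a) * ‖f t‖ ≤ M := by
  obtain ⟨g, hg, hfg⟩ := exists_eq_prod_sub_pow_mul hf S hm
  set N := ∑ a ∈ S, m a with hN
  -- On the circle each factor is at least `R - 1 ≥ 6`; on `‖t‖ ≤ 2` it is at most 3.
  have hgt : ‖g t‖ ≤ M / 6 ^ N := by
    refine Complex.norm_le_of_forall_mem_frontier_norm_le (U := Metric.ball 0 R)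
      Metric.isBounded_ball hg.diffContOnCl (fun z hz ↦ ?_) (subset_closure ?_)
    · rw [frontier_ball _ (by linarith), mem_sphere_zero_iff_norm] at hz
      rw [le_div_iff₀ (by positivity), mul_comm]
      refine le_trans ?_ (hM z hz)
      rw [hfg, norm_mul, norm_prod, hN, ← Finset.prod_pow_eq_pow_sum]
      gcongr with a ha
      rw [norm_pow]
      gcongr
      linarith [norm_sub_norm_le z a, hS a ha]
    · rw [mem_ball_zero_iff]; linarith
  have hp : ‖∏ a ∈ S, (t - a) ^ m a‖ ≤ 3 ^ N := by
    rw [norm_prod, hN, ← Finset.prod_pow_eq_pow_sum]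
    gcongr with a ha
    rw [norm_pow]
    gcongr
    linarith [norm_sub_le t a, hS a ha]
  rw [hfg, norm_mul]
  calc (2 : ℝ) ^ N * (_ * _) ≤ 2 ^ N * (3 ^ N * (M / 6 ^ N)) := by gcongr
    _ = M := by
      rw [show (6 : ℝ) = 2 * 3 by norm_num, mul_pow]; field_simp

/-! ### Growth of solutions -/

/-- Where `a₀` is not small, the equation bounds the `n`-th derivative by the lower ones. -/
lemma IsEntireSolution.norm_iteratedDeriv_le {n : ℕ} {a : Fin (n + 1) → ℂ[X]} {y : ℂ → ℂ}
    (hsol : IsEntireSolution a y) {d : ℕ} {K l J : ℝ} (hK : 0 ≤ K)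
    (hdeg : ∀ k, (a k).natDegree ≤ d) (haK : ∀ k, k ≠ 0 → polyL1Norm (a k) ≤ K)
    (hl1 : 1 ≤ l) (hl : n * K * 648 ^ d ≤ l) {t : ℂ} (ht : ‖t‖ ≤ 9)
    (h0 : 1 ≤ 72 ^ d * ‖(a 0).eval t‖) (hJ : 0 ≤ J) (hjet : JetBound y l n J t) :
    ‖iteratedDeriv n y t‖ ≤ J * l ^ n := by
  rcases Nat.eq_zero_or_pos n with rfl | hn
  · have := hsol.2 t
    simp only [Nat.reduceAdd, Finset.univ_unique, Finset.sum_singleton, mul_eq_zero] at this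
    rcases this with h | h
    · rw [show (0 : Fin (0 + 1)) = default from rfl, h] at h0
      norm_num at h0
    · simp only [Nat.zero_sub] at h
      simp [h, hJ]
  have hs := hsol.2 t
  rw [Fin.sum_univ_succ] at hs
  simp only [Fin.val_zero, Nat.sub_zero, Fin.val_succ] at hs
  have hb : ‖(a 0).eval t‖ * ‖iteratedDeriv n y t‖ ≤ n * (K * 9 ^ d * (J * l ^ (n - 1))) := by
    rw [← norm_mul, eq_neg_of_add_eq_zero_left hs, norm_neg]
    refine (norm_sum_le_of_le (f := fun i : Fin n ↦ _) Finset.univ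
      (n := fun _ ↦ K * 9 ^ d * (J * l ^ (n - 1))) fun i _ ↦ ?_).trans_eq (by simp)
    rw [norm_mul]
    gcongr
    · refine (norm_eval_le_polyL1Norm_mul (hdeg _) (by norm_num) ht).trans ?_
      gcongr
      exact haK _ (Fin.succ_ne_zero i)
    · refine (hjet _ (by omega)).trans ?_
      exact mul_le_mul_of_nonneg_left (pow_le_pow_right₀ hl1 (by omega)) hJ
  calc ‖iteratedDeriv n y t‖ ≤ 72 ^ d * ‖(a 0).eval t‖ * ‖iteratedDeriv n y t‖ :=
        le_mul_of_one_le_left (norm_nonneg _) h0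
    _ ≤ 72 ^ d * (n * (K * 9 ^ d * (J * l ^ (n - 1)))) := by
        rw [mul_assoc]; gcongr
    _ = n * K * 648 ^ d * (J * l ^ (n - 1)) := by
        rw [show (648 : ℝ) = 72 * 9 by norm_num, mul_pow]; ring
    _ ≤ l * (J * l ^ (n - 1)) := by gcongr
    _ = J * l ^ n := by
        obtain ⟨k, rfl⟩ := Nat.exists_eq_succ_of_ne_zero hn.ne'
        simp only [Nat.succ_eq_add_one, Nat.add_sub_cancel, pow_succ]; ring

/-- Growth of a solution from the disk `‖t‖ ≤ 2` to a circle of larger radius. -/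
lemma IsEntireSolution.exists_circle_norm_le {n : ℕ} {a : Fin (n + 1) → ℂ[X]} {y : ℂ → ℂ}
    (hsol : IsEntireSolution a y) {d : ℕ} {K l m : ℝ} (hn : 0 < n) (hK : 0 ≤ K)
    (hdeg : ∀ k, (a k).natDegree ≤ d) (h1 : polyL1Norm (a 0) = 1)
    (haK : ∀ k, k ≠ 0 → polyL1Norm (a k) ≤ K)
    (hnl : n ≤ l) (hl : n * K * 648 ^ d ≤ l) (hm : ∀ t, ‖t‖ ≤ 2 → ‖y t‖ ≤ m) :
    ∃ R, 7 ≤ R ∧ ∀ t, ‖t‖ = R → ‖y t‖ ≤ m * Real.exp (72 * l) := by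
  obtain ⟨R, hR, hcirc⟩ := exists_circle_le_norm_eval (hdeg 0) h1
  obtain ⟨h, hh, hline⟩ := exists_line_le_norm_eval (hdeg 0) h1
  refine ⟨R, hR.1, fun t ht ↦ ?_⟩
  have hn1 : (1 : ℝ) ≤ n := by exact_mod_cast hn
  have hl1 : 1 ≤ l := hn1.trans hnl
  have hm0 : 0 ≤ m := (norm_nonneg _).trans (hm 0 (by simp))
  have hh1 : |h| ≤ 1 := abs_le.mpr hh
  have hh2 : h ^ 2 ≤ 1 := by rw [← sq_abs]; exact pow_le_one₀ (abs_nonneg h) hh1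
  -- Cauchy's estimate on the unit circle about `ih`, which lies in `‖t‖ ≤ 2`; then `k! ≤ k ^ k ≤ l
  -- ^ k`.
  have hjet0 : JetBound y l n m (h * Complex.I) := by
    intro k hk
    have := Complex.norm_iteratedDeriv_le_of_forall_mem_sphere_norm_le (c := h * Complex.I) k
      one_pos hsol.1.diffContOnCl (C := m) fun z hz ↦ hm z (by
        rw [mem_sphere_iff_norm] at hz
        calc ‖z‖ = ‖(z - h * Complex.I) + h * Complex.I‖ := by ring_nf
          _ ≤ 1 + 1 := (norm_add_le _ _).trans (add_le_add hz.le (by simpa using hh1))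
          _ = 2 := by norm_num)
    rw [one_pow, div_one, mul_comm _ m] at this
    refine this.trans ?_
    gcongr
    calc (k.factorial : ℝ) ≤ (k : ℝ) ^ k := by exact_mod_cast Nat.factorial_le_pow k
      _ ≤ l ^ k := by
        gcongr
        exact (Nat.cast_le.mpr hk.le).trans hnl
  set L := √(R ^ 2 - h ^ 2) with hL
  have hL2 : L ^ 2 = R ^ 2 - h ^ 2 := Real.sq_sqrt (by nlinarith [hR.1])
  have hL0 : 0 ≤ L := Real.sqrt_nonneg _
  have hL9 : L ≤ 9 := by nlinarith [hR.1, hR.2, sq_nonneg h]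
  have hnormsq : ∀ s : ℝ, ‖(s : ℂ) + h * Complex.I‖ ^ 2 = s ^ 2 + h ^ 2 := by
    intro s
    rw [Complex.sq_norm, Complex.normSq_add_mul_I]
  have hode : ∀ z : ℂ, ‖z‖ ≤ 9 → 1 ≤ 72 ^ d * ‖(a 0).eval z‖ → ∀ J, 0 ≤ J →
      JetBound y l n J z → ‖iteratedDeriv n y z‖ ≤ J * l ^ n := fun z hz hz' J hJ hj ↦
    hsol.norm_iteratedDeriv_le hK hdeg haK hl1 hl hz hz' hJ hj
  have hjet1 : JetBound y l n (m * Real.exp (l * 1 * L)) (L + h * Complex.I) := by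
    refine JetBound.along_path hsol.1 (γ := fun s : ℝ ↦ (s : ℂ) + h * Complex.I)
      (γ' := fun _ ↦ 1) (by linarith) hL0 hm0
      (fun s ↦ (Complex.ofRealCLM.hasDerivAt (x := s)).add_const _) (by simp) (by simpa using hjet0)
      fun s hs ↦ ?_
    have h9 : ‖(s : ℂ) + h * Complex.I‖ ≤ 9 := by
      refine le_of_sq_le_sq ?_ (by norm_num)
      rw [hnormsq]
      nlinarith [hs.1, hs.2, hR.1, hR.2]
    exact hode _ h9 (hline _ h9 (by simp))
  have hw : ‖(L : ℂ) + h * Complex.I‖ = R := by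
    rw [← sq_eq_sq₀ (norm_nonneg _) (by linarith [hR.1]), hnormsq, hL2]; ring
  set w : ℂ := L + h * Complex.I with hwdef
  have hw0 : w ≠ 0 := by
    rw [← norm_pos_iff, hw]; linarith [hR.1]
  have hq : ‖t / w‖ = 1 := by
    rw [norm_div, ht, hw, div_self (by linarith [hR.1])]
  obtain ⟨s₀, hs₀, hs₀t⟩ : ∃ s ∈ Set.Icc 0 (2 * Real.pi), Complex.exp (s * Complex.I) = t / w := by
    obtain ⟨θ, hθ⟩ := (Complex.norm_eq_one_iff _).mp hq
    refine ⟨toIcoMod Real.two_pi_pos 0 θ, ?_, ?_⟩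
    · have := toIcoMod_mem_Ico Real.two_pi_pos 0 θ
      exact ⟨this.1, by simpa using this.2.le⟩
    · rw [← hθ, Complex.exp_eq_exp_iff_exists_int]
      refine ⟨-toIcoDiv Real.two_pi_pos 0 θ, ?_⟩
      rw [← self_sub_toIcoDiv_zsmul]
      push_cast [zsmul_eq_mul]
      ring
  have hnexp : ∀ s : ℝ, ‖w * Complex.exp (s * Complex.I)‖ = R := by
    intro s
    rw [norm_mul, Complex.norm_exp_ofReal_mul_I, mul_one, hw]
  have hjet2 := JetBound.along_path hsol.1 (L := s₀) (v := R) (m := m * Real.exp (l * 1 * L))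
    (γ := fun s : ℝ ↦ w * Complex.exp (s * Complex.I))
    (γ' := fun s : ℝ ↦ w * Complex.exp (s * Complex.I) * Complex.I) (by linarith) hs₀.1
    (by positivity)
    (fun s ↦ by
      have := ((Complex.ofRealCLM.hasDerivAt (x := s)).mul_const Complex.I).cexp.const_mul w
      simpa [mul_assoc] using this)
    (fun s ↦ by rw [norm_mul, hnexp]; simp) (by simpa using hjet1)
    fun s _ ↦ hode _ (by rw [hnexp]; exact hR.2) (hcirc _ (hnexp s))
  have := hjet2 0 hn
  rw [hs₀t, mul_div_cancel₀ _ hw0] at this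
  simp only [iteratedDeriv_zero, pow_zero, mul_one] at this
  refine this.trans ?_
  rw [mul_assoc, ← Real.exp_add]
  have hR0 : (0 : ℝ) ≤ R := by linarith [hR.1]
  -- The arc has length at most `9 * 2π < 63`; with the segment, of length at most 9, this gives 72.
  have hRs : R * s₀ ≤ 9 * 7 := by
    have hpi := Real.pi_lt_d2
    exact mul_le_mul hR.2 (by linarith [hs₀.2]) hs₀.1 (by norm_num)
  gcongr
  nlinarith

/-! ### Isolated zeros and the final count -/

lemma isolatedZerosInUnitDisk_zero : isolatedZerosInUnitDisk (fun _ ↦ 0) = ∅ := by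
  ext t
  simp [isolatedZerosInUnitDisk, NeBot.ne]

lemma exists_norm_le_two_ne_zero {y : ℂ → ℂ} (hy : Differentiable ℂ y) (h : y ≠ fun _ ↦ 0) :
    ∃ t, ‖t‖ ≤ 2 ∧ y t ≠ 0 := by
  by_contra! hc
  refine h (AnalyticOnNhd.eq_of_eventuallyEq (z₀ := 0) (fun z _ ↦ hy.analyticAt z)
    (fun z _ ↦ analyticAt_const) ?_)
  filter_upwards [Metric.closedBall_mem_nhds (0 : ℂ) two_pos] with z hz
  exact hc z (by simpa using hz)

lemma isolatedZerosInUnitDisk_finite {y : ℂ → ℂ} (hy : Differentiable ℂ y)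
    (h : y ≠ fun _ ↦ 0) : (isolatedZerosInUnitDisk y).Finite := by
  obtain ⟨x, -, hx⟩ := exists_norm_le_two_ne_zero hy h
  have han : AnalyticOnNhd ℂ y Set.univ := fun z _ ↦ hy.analyticAt z
  by_contra hinf
  obtain ⟨z, -, hz⟩ := Set.Infinite.exists_accPt_of_subset_isCompact
    (s := isolatedZerosInUnitDisk y) hinf (isCompact_closedBall (0 : ℂ) 1)
    fun t ht ↦ by simpa using ht.1.le
  have hfr : ∃ᶠ w in 𝓝[≠] z, y w = 0 :=
    (accPt_iff_frequently_nhdsNE.mp hz).mono fun w hw ↦ hw.2.1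
  exact hx (han.eqOn_zero_of_preconnected_of_frequently_eq_zero isPreconnected_univ
    (Set.mem_univ z) hfr (Set.mem_univ x))

/-- There is an absolute constant `C` such that an entire solution of an equation of order `n`
with polynomial coefficients of degree `≤ d` (`d ≥ 1`), `‖a₀‖ = 1` and `‖aₖ‖ ≤ K`, has at most
`max(K, 1) · n · 2 ^ (C d)` isolated zeros in the unit disk, counted with multiplicity. -/
theorem mainTheorem7 :
    ∃ C : ℕ, ∀ (n d : ℕ) (K : ℝ) (a : Fin (n + 1) → ℂ[X]) (y : ℂ → ℂ),
      1 ≤ d →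
      (∀ k, (a k).natDegree ≤ d) →
      polyL1Norm (a 0) = 1 →
      (∀ k, k ≠ 0 → polyL1Norm (a k) ≤ K) →
      IsEntireSolution a y →
      (isolatedZerosInUnitDisk y).Finite ∧
        ∑ᶠ t ∈ isolatedZerosInUnitDisk y, (analyticOrderNatAt y t : ℝ)
          ≤ max K 1 * n * 2 ^ (C * d) := by
  refine ⟨18, fun n d K a y hd hdeg h1 haK hsol ↦ ?_⟩
  by_cases hy0 : y = fun _ ↦ 0
  · rw [hy0, isolatedZerosInUnitDisk_zero]
    refine ⟨Set.finite_empty, ?_⟩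
    simp only [Set.mem_empty_iff_false, finsum_false, finsum_zero]
    positivity
  have hfin := isolatedZerosInUnitDisk_finite hsol.1 hy0
  refine ⟨hfin, ?_⟩
  rcases Nat.eq_zero_or_pos n with rfl | hn
  -- For `n = 0` the equation is `a₀ y = 0`, so `y` vanishes off the finitely many roots of `a₀`,
  -- hence everywhere by continuity.
  · refine absurd ?_ hy0
    have h0 : a 0 ≠ 0 := by rintro h; simp [h, polyL1Norm] at h1
    refine Continuous.ext_on ((a 0).roots.toFinset.countable_toSet.dense_compl ℂ) hsol.1.continuous
      continuous_const fun t ht ↦ ?_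
    have := hsol.2 t
    simp only [Nat.reduceAdd, Finset.univ_unique, Finset.sum_singleton, mul_eq_zero] at this
    rcases this with h | h
    · exact absurd (by simpa [h0] using h) ht
    · simpa using h
  have hn1 : (1 : ℝ) ≤ n := by exact_mod_cast hn
  have hK : 0 ≤ K := (polyL1Norm_nonneg _).trans (haK (Fin.last n) (by
    rw [Ne, Fin.ext_iff]; simpa using hn.ne'))
  set l : ℝ := max K 1 * n * 648 ^ d with hl
  have h648 : (1 : ℝ) ≤ 648 ^ d := one_le_pow₀ (by norm_num)
  have hnl : n ≤ l := by
    calc (n : ℝ) = 1 * n * 1 := by ring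
      _ ≤ l := by rw [hl]; gcongr; exact le_max_right _ _
  have hKl : n * K * 648 ^ d ≤ l := by
    rw [hl, mul_comm (n : ℝ) K]; gcongr; exact le_max_left _ _
  obtain ⟨t₀, ht₀, hmax⟩ := (isCompact_closedBall (0 : ℂ) 2).exists_isMaxOn
    ⟨0, by simp⟩ (f := fun t ↦ ‖y t‖) hsol.1.continuous.norm.continuousOn
  have hm : ∀ t, ‖t‖ ≤ 2 → ‖y t‖ ≤ ‖y t₀‖ := fun t ht ↦ hmax (by simpa using ht)
  have hpos : 0 < ‖y t₀‖ := by
    obtain ⟨x, hx, hx'⟩ := exists_norm_le_two_ne_zero hsol.1 hy0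
    exact (norm_pos_iff.mpr hx').trans_le (hm x hx)
  obtain ⟨R, hR, hgrow⟩ := hsol.exists_circle_norm_le hn hK hdeg h1 haK hnl hKl hm
  have hcount := two_pow_mul_norm_le hsol.1 (S := hfin.toFinset) (m := analyticOrderNatAt y)
    (fun t ht ↦ ((hfin.mem_toFinset.mp ht).1).le)
    (fun t _ ↦ ENat.natCast_toNat_le_self _) hR hgrow (t := t₀) (by simpa using ht₀)
  rw [finsum_mem_eq_finite_toFinset_sum _ hfin, ← Nat.cast_sum]
  set N := ∑ t ∈ hfin.toFinset, analyticOrderNatAt y t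
  have h2 : (2 : ℝ) ^ N ≤ Real.exp (72 * l) :=
    le_of_mul_le_mul_right (by rwa [mul_comm ‖y t₀‖] at hcount) hpos
  have h3 : N * Real.log 2 ≤ 72 * l := by
    rw [← Real.log_pow]
    exact (Real.log_le_iff_le_exp (by positivity)).mpr h2
  have h4 : (N : ℝ) ≤ 144 * l := by
    have := Real.log_two_gt_d9
    nlinarith [Nat.cast_nonneg (α := ℝ) N]
  refine h4.trans ?_
  calc 144 * l = max K 1 * n * (144 * 648 ^ d) := by rw [hl]; ring
    -- Here `d ≥ 1` absorbs the constant 144; the exponent is `18 = 8 + 10`.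
    _ ≤ max K 1 * n * (256 ^ d * 1024 ^ d) := by
        gcongr
        · calc (144 : ℝ) ≤ 256 ^ 1 := by norm_num
            _ ≤ 256 ^ d := pow_le_pow_right₀ (by norm_num) hd
        · norm_num
    _ = max K 1 * n * 2 ^ (18 * d) := by
        rw [← mul_pow, pow_mul]; norm_num
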